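/- A simple polygon is the closed region in the plane bounded by a closed polygonal curve without self-intersections. Let $\mathcal{I}$ be a finite set of pairwise disjoint simple polygons in $\mathbb{R}^2$, no three of whose vertices lie on a common line. For $\mathcal{Q}\subseteq\mathcal{I}$ write $\mathrm{CH}(\mathcal{Q})$ for the convex hull of the union of the polygons of $\mathcal{Q}$. The set $\mathcal{Q}$ is *bridgeable* by a finite set $S$ of closed segments with pairwise disjoint relative interiors if (i) $\bigcup\mathcal{Q}\cup\bigcup S$ is connected (and non-empty); (ii) the relative interior of every segment of $S$ is disjoint from the interior of every polygon of $\mathcal{I}$; (iii) every polygon of $\mathcal{I}$ that meets a segment of $S$ belongs to $\mathcal{Q}$; (iv) every segment of $S$ has at least one endpoint on the boundary of a polygon of $\mathcal{Q}$; (v) every segment of $S$ is contained in $\mathrm{CH}(\mathcal{Q})$. The set $\mathcal{Q}$ is *bridgeable* if it is bridgeable by some such $S$. Two sets $\mathcal{P}_1,\mathcal{P}_2\subseteq\mathcal{I}$ are *compatible* if $\mathcal{P}_1\cap\mathcal{P}_2=\emptyset$, there are sets $S_1,S_2$ of segments such that $\mathcal{P}_1$ is bridgeable by $S_1$, $\mathcal{P}_2$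 is bridgeable by $S_2$ and every segment of $S_1$ is disjoint from every segment of $S_2$, and $\mathcal{P}_1\cup\mathcal{P}_2$ is bridgeable. **Lemma.** If $\mathcal{P}_1,\mathcal{P}_2\subseteq\mathcal{I}$ are compatible, then $\partial\,\mathrm{CH}(\mathcal{P}_1)\cap\partial\,\mathrm{CH}(\mathcal{P}_2)$ consists of at most two points; that is, the two hulls behave like pseudo-disks (regions whose boundaries intersect at most twice). -/

import Mathlib

/-- The Euclidean plane. -/
abbrev Plane : Type := EuclideanSpace ℝ (Fin 2)

/-- A simple polygon in the plane: a cyclic sequence of at least three vertices whose closed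
polygonal boundary curve does not meet itself. -/
structure SimplePolygon where
  /-- The number of vertices. -/
  n : ℕ
  /-- The cyclic sequence of vertices. -/
  toPolygon : Polygon Plane n
  three_le : 3 ≤ n
  /-- The boundary curve, which runs through the `i`-th edge for `t ∈ [0, 1)`, is injective. -/
  simple : Set.InjOn (fun q : Fin n × ℝ => toPolygon.edgePath ℝ q.1 q.2)
    (Set.univ ×ˢ Set.Ico (0 : ℝ) 1)

namespace SimplePolygon

/-- The boundary curve of a simple polygon, as a set. -/
def boundary (P : SimplePolygon) : Set Plane :=
  P.toPolygon.boundary ℝ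

/-- The set of vertices of a simple polygon. -/
def vertexSet (P : SimplePolygon) : Set Plane :=
  Set.range P.toPolygon.vertices

/-- The closed region of the plane that a simple polygon stands for: its boundary curve together
with all points that lie in a bounded connected component of the complement of that curve. -/
def region (P : SimplePolygon) : Set Plane :=
  P.boundary ∪
    {x | x ∉ P.boundary ∧ Bornology.IsBounded (connectedComponentIn P.boundaryᶜ x)}

end SimplePolygon

/-- A closed nondegenerate line segment in the plane, given by its endpoints. -/
structure PlaneSegment where
  a : Plane
  b : Plane
  ne : a ≠ b

namespace PlaneSegment

/-- The closed segment as a set. -/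
def carrier (s : PlaneSegment) : Set Plane := segment ℝ s.a s.b

/-- The relative interior of the segment. -/
def relInterior (s : PlaneSegment) : Set Plane := openSegment ℝ s.a s.b

end PlaneSegment

/-- The union of a set of polygons. -/
def polyUnion (Q : Set SimplePolygon) : Set Plane := ⋃ P ∈ Q, P.region

/-- The union of a set of segments. -/
def segUnion (S : Set PlaneSegment) : Set Plane := ⋃ s ∈ S, s.carrier

/-- The combined convex hull of a set of polygons. -/
def hull (Q : Set SimplePolygon) : Set Plane := convexHull ℝ (polyUnion Q)

/-- A finite set of pairwise disjoint simple polygons, no three of whose vertices are collinear. -/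
structure IsPolygonInput (I : Set SimplePolygon) : Prop where
  finite : I.Finite
  disjoint : I.Pairwise fun P P' => Disjoint P.region P'.region
  generalPosition : ∀ x ∈ ⋃ P ∈ I, P.vertexSet, ∀ y ∈ ⋃ P ∈ I, P.vertexSet,
    ∀ z ∈ ⋃ P ∈ I, P.vertexSet, x ≠ y → y ≠ z → x ≠ z → ¬ Collinear ℝ {x, y, z}

/-- The set `Q ⊆ I` of polygons is bridgeable by the finite set `S` of segments. -/
structure BridgeableBy (I Q : Set SimplePolygon) (S : Set PlaneSegment) : Prop where
  subset : Q ⊆ I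
  finite : S.Finite
  /-- The segments are pairwise interior disjoint. -/
  interiorDisjoint : S.Pairwise fun s s' => Disjoint s.relInterior s'.relInterior
  connected : IsConnected (polyUnion Q ∪ segUnion S)
  /-- The segments and the polygons of `I` are interior disjoint. -/
  interiorDisjoint_polygon : ∀ s ∈ S, ∀ P ∈ I, Disjoint s.relInterior (interior P.region)
  /-- The segments meet no polygon of `I` outside `Q`. -/
  mem_of_meets : ∀ s ∈ S, ∀ P ∈ I, (s.carrier ∩ P.region).Nonempty → P ∈ Q
  /-- Each segment has at least one endpoint on the boundary of a polygon of `Q`. -/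
  endpoint : ∀ s ∈ S, ∃ P ∈ Q, s.a ∈ P.boundary ∨ s.b ∈ P.boundary
  /-- The segments lie within the convex hull of `Q`. -/
  subset_hull : ∀ s ∈ S, s.carrier ⊆ hull Q

/-- The set `Q ⊆ I` of polygons is bridgeable. -/
def Bridgeable (I Q : Set SimplePolygon) : Prop := ∃ S, BridgeableBy I Q S

/-- Two sets of polygons of `I` are compatible. -/
def Compatible (I P₁ P₂ : Set SimplePolygon) : Prop :=
  Disjoint P₁ P₂ ∧
  (∃ S₁ S₂ : Set PlaneSegment, BridgeableBy I P₁ S₁ ∧ BridgeableBy I P₂ S₂ ∧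
    ∀ s₁ ∈ S₁, ∀ s₂ ∈ S₂, Disjoint s₁.carrier s₂.carrier) ∧
  Bridgeable I (P₁ ∪ P₂)

/-!
A common boundary point `p` of the two hulls is not a vertex, since the vertices are in general
position. Hence `p` is an interior point of an edge of each hull, and the two edges cross at `p`.
Directing every hull edge so that its hull lies on the left, there are two kinds of crossings,
according to the sign of the turn from the first edge to the second, and it suffices to see that
there is at most one crossing of each kind.

Suppose two crossings of the same kind come from edges starting at the vertices `v₁, v₂` of the
first hull and edges ending at the vertices `t₁, t₂` of the second. The polygons and segments of
each family form connected closed sets `K ∋ v₁, v₂` and `L ∋ t₁, t₂`, which are disjoint, so there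
are disjoint curves `γ` from `v₁` to `v₂` close to `K` and `δ` from `t₁` to `t₂` close to `L`. The
vector `δ t - γ s` never vanishes and thus has a continuous angle on the parameter square. On each
side of the square this vector stays in an open half-plane, because one endpoint is fixed at a
hull vertex, so the change of the angle is read off from the endpoints of the side; the crossings
are such that it increases on all four sides. This is impossible on a closed loop.
-/

/-- The wedge product `u × v` of two plane vectors, positive when `v` points to the left of `u`. -/
def wedge (u v : Plane) : ℝ := u 0 * v 1 - u 1 * v 0

section Wedge

theorem wedge_smul_left (a : ℝ) (u v : Plane) : wedge (a • u) v = a * wedge u v := by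
  simp only [wedge, PiLp.smul_apply, smul_eq_mul]
  ring

theorem wedge_smul_right (a : ℝ) (u v : Plane) : wedge u (a • v) = a * wedge u v := by
  simp only [wedge, PiLp.smul_apply, smul_eq_mul]
  ring

theorem wedge_self (u : Plane) : wedge u u = 0 := by
  simp only [wedge]
  ring

theorem wedge_swap (u v : Plane) : wedge u v = -wedge v u := by
  simp only [wedge]
  ring

theorem wedge_plucker (a b q s : Plane) :
    wedge a b * wedge q s - wedge a q * wedge b s + wedge a s * wedge b q = 0 := by
  simp only [wedge]
  ring

theorem wedge_smul_eq (a b q : Plane) : wedge a b • q = wedge a q • b - wedge b q • a := by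
  ext i
  fin_cases i <;>
    simp only [wedge, Fin.zero_eta, Fin.mk_one, PiLp.smul_apply, smul_eq_mul, PiLp.sub_apply] <;>
    ring

theorem wedge_eq_zero_iff {c : Plane} (hc : c ≠ 0) {u : Plane} :
    wedge c u = 0 ↔ ∃ t : ℝ, u = t • c := by
  refine ⟨fun h ↦ ?_, ?_⟩
  · have hnorm : c 0 ^ 2 + c 1 ^ 2 ≠ 0 := by
      contrapose! hc
      ext i
      fin_cases i <;> simp only [Fin.zero_eta, Fin.mk_one, PiLp.zero_apply] <;> nlinarith
    refine ⟨(c 0 * u 0 + c 1 * u 1) / (c 0 ^ 2 + c 1 ^ 2), ?_⟩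
    simp only [wedge] at h
    ext i
    fin_cases i <;>
      simp only [Fin.zero_eta, Fin.mk_one, PiLp.smul_apply, smul_eq_mul] <;> field_simp
    · linear_combination -c 1 * h
    · linear_combination c 0 * h
  · rintro ⟨t, rfl⟩
    rw [wedge_smul_right, wedge_self, mul_zero]

theorem exists_eq_wedge (f : StrongDual ℝ Plane) : ∃ c, ∀ x, f x = wedge c x := by
  let e (i : Fin 2) : Plane := EuclideanSpace.single i 1
  refine ⟨!₂[f (e 1), -f (e 0)], fun x ↦ ?_⟩
  have hx : x = x 0 • e 0 + x 1 • e 1 := by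
    ext i
    fin_cases i <;> simp [e]
  calc f x = x 0 * f (e 0) + x 1 * f (e 1) := by
        rw [← smul_eq_mul, ← smul_eq_mul, ← map_smul, ← map_smul, ← map_add, ← hx]
    _ = f (e 1) * x 1 - -f (e 0) * x 0 := by ring

@[fun_prop]
theorem continuous_wedge {X : Type*} [TopologicalSpace X] {u v : X → Plane} (hu : Continuous u)
    (hv : Continuous v) : Continuous fun x ↦ wedge (u x) (v x) := by
  unfold wedge
  fun_prop

end Wedge

section Angle

/-- The unit vector of the plane with polar angle `α`. -/
noncomputable def unitVector (α : ℝ) : Plane := !₂[Real.cos α, Real.sin α]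

theorem wedge_eq_mul_sin {u v : Plane} {α β : ℝ} (hu : u = ‖u‖ • unitVector α)
    (hv : v = ‖v‖ • unitVector β) : wedge u v = ‖u‖ * ‖v‖ * Real.sin (β - α) := by
  calc wedge u v = wedge (‖u‖ • unitVector α) (‖v‖ • unitVector β) := by rw [← hu, ← hv]
    _ = ‖u‖ * ‖v‖ * Real.sin (β - α) := by
      simp only [wedge, unitVector, PiLp.smul_apply, Matrix.cons_val_zero, Matrix.cons_val_one,
        Matrix.cons_val_fin_one, smul_eq_mul, Real.sin_sub]
      ring

theorem eq_norm_smul_unitVector_of_exp_eq {u : Plane} {z : ℂ}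
    (h : Complex.exp z = Complex.orthonormalBasisOneI.repr.symm u) :
    u = ‖u‖ • unitVector z.im := by
  have hu : u = Complex.orthonormalBasisOneI.repr (Complex.exp z) := by
    rw [h, LinearIsometryEquiv.apply_symm_apply]
  rw [hu, LinearIsometryEquiv.norm_map, Complex.norm_exp]
  ext i
  fin_cases i <;> simp [unitVector, Complex.exp_re, Complex.exp_im]

theorem exists_eq_norm_smul_unitVector {u : Plane} (hu : u ≠ 0) :
    ∃ α, u = ‖u‖ • unitVector α :=
  ⟨_, eq_norm_smul_unitVector_of_exp_eq
    (Complex.exp_log ((map_ne_zero_iff _ (LinearIsometryEquiv.injective _)).2 hu))⟩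

variable {X : Type*} [TopologicalSpace X]

theorem exists_continuous_angle [SimplyConnectedSpace X] [LocallyPathConnectedSpace X]
    {w : X → Plane} (hw : Continuous w) (h₀ : ∀ x, w x ≠ 0) :
    ∃ θ : X → ℝ, Continuous θ ∧ ∀ x, w x = ‖w x‖ • unitVector (θ x) := by
  obtain ⟨h, hcont, hexp⟩ := Complex.exists_continuousOn_eqOn_exp_comp
    (g := fun x ↦ Complex.orthonormalBasisOneI.repr.symm (w x))
    (Homeomorph.Set.univ X).toHomotopyEquiv.simplyConnectedSpace isOpen_univ (by fun_prop)
    (fun ⟨x, _, hx⟩ ↦ h₀ x ((map_eq_zero_iff _ (LinearIsometryEquiv.injective _)).1 hx))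
  rw [continuousOn_univ] at hcont
  exact ⟨fun x ↦ (h x).im, by fun_prop,
    fun x ↦ eq_norm_smul_unitVector_of_exp_eq (hexp (Set.mem_univ x))⟩

theorem lt_of_sin_sub_pos [PreconnectedSpace X] {θ : X → ℝ} (hθ : Continuous θ) {α : ℝ}
    (hα : ∀ x, 0 < Real.sin (θ x - α)) {x y : X} (hxy : 0 < Real.sin (θ y - θ x)) :
    θ x < θ y := by
  by_contra! hle
  have hfar : θ y ≤ θ x - Real.pi := by
    by_contra! hlt
    exact hxy.not_ge (Real.sin_nonpos_of_nonpos_of_neg_pi_le (by linarith) (by linarith))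
  obtain ⟨z, hz⟩ := mem_range_of_exists_le_of_exists_ge hθ ⟨y, hfar⟩
    ⟨x, sub_le_self _ Real.pi_pos.le⟩
  have hneg : Real.sin (θ z - α) = -Real.sin (θ x - α) := by
    rw [hz, sub_right_comm, Real.sin_sub_pi]
  linarith [hα x, hα z]

theorem angle_lt_angle [PreconnectedSpace X] {w : X → Plane} {θ : X → ℝ} (hθ : Continuous θ)
    (hw : ∀ x, w x = ‖w x‖ • unitVector (θ x)) {c : Plane} (hc : ∀ x, 0 < wedge c (w x))
    {x y : X} (hxy : 0 < wedge (w x) (w y)) : θ x < θ y := by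
  have hc₀ : c ≠ 0 := by
    rintro rfl
    simpa [wedge] using hc x
  obtain ⟨α, hα⟩ := exists_eq_norm_smul_unitVector hc₀
  refine lt_of_sin_sub_pos hθ (α := α) (fun z ↦ ?_) ?_
  · exact pos_of_mul_pos_right (wedge_eq_mul_sin hα (hw z) ▸ hc z) (by positivity)
  · exact pos_of_mul_pos_right (wedge_eq_mul_sin (hw x) (hw y) ▸ hxy) (by positivity)

end Angle

section Quadrilateral

theorem exists_eq_of_turns {X Y : Type*} [TopologicalSpace X] [TopologicalSpace Y]
    [ContractibleSpace X] [ContractibleSpace Y] [LocallyPathConnectedSpace X]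
    [LocallyPathConnectedSpace Y] {γ : X → Plane} {δ : Y → Plane} (hγ : Continuous γ)
    (hδ : Continuous δ) {s₁ s₂ : X} {t₁ t₂ : Y} {c₁ c₂ d₁ d₂ : Plane}
    (hc₁ : ∀ t, 0 < wedge c₁ (δ t - γ s₁)) (hc₂ : ∀ t, 0 < wedge c₂ (δ t - γ s₂))
    (hd₁ : ∀ s, 0 < wedge d₁ (δ t₁ - γ s)) (hd₂ : ∀ s, 0 < wedge d₂ (δ t₂ - γ s))
    (h₁ : 0 < wedge (δ t₁ - γ s₁) (δ t₂ - γ s₁)) (h₂ : 0 < wedge (δ t₂ - γ s₁) (δ t₂ - γ s₂))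
    (h₃ : 0 < wedge (δ t₂ - γ s₂) (δ t₁ - γ s₂)) (h₄ : 0 < wedge (δ t₁ - γ s₂) (δ t₁ - γ s₁)) :
    ∃ s t, γ s = δ t := by
  by_contra! hne
  obtain ⟨θ, hθ, hw⟩ := exists_continuous_angle (w := fun p : X × Y ↦ δ p.2 - γ p.1)
    (by fun_prop) (fun p ↦ sub_ne_zero.2 (hne p.1 p.2).symm)
  have side₁ : θ (s₁, t₁) < θ (s₁, t₂) :=
    angle_lt_angle (by fun_prop) (fun t ↦ hw (s₁, t)) hc₁ h₁
  have side₂ : θ (s₁, t₂) < θ (s₂, t₂) :=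
    angle_lt_angle (θ := fun s ↦ θ (s, t₂)) (by fun_prop) (fun s ↦ hw (s, t₂)) hd₂ h₂
  have side₃ : θ (s₂, t₂) < θ (s₂, t₁) :=
    angle_lt_angle (by fun_prop) (fun t ↦ hw (s₂, t)) hc₂ h₃
  have side₄ : θ (s₂, t₁) < θ (s₁, t₁) :=
    angle_lt_angle (θ := fun s ↦ θ (s, t₁)) (by fun_prop) (fun s ↦ hw (s, t₁)) hd₁ h₄
  exact lt_irrefl _ (side₁.trans (side₂.trans (side₃.trans side₄)))

theorem exists_curve_of_isPreconnected {X : Type*} [TopologicalSpace X]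
    [LocallyPathConnectedSpace X] {K U : Set X} (hK : IsPreconnected K) (hU : IsOpen U)
    (hKU : K ⊆ U) {x y : X} (hx : x ∈ K) (hy : y ∈ K) :
    ∃ γ : ℝ → X, Continuous γ ∧ (∀ t, γ t ∈ U) ∧ γ 0 = x ∧ γ 1 = y := by
  have hcomp : IsPathConnected (connectedComponentIn U x) :=
    hU.connectedComponentIn.isConnected_iff_isPathConnected.1
      (isConnected_connectedComponentIn_iff.2 (hKU hx))
  obtain ⟨γ, hγ⟩ := hcomp.joinedIn x (mem_connectedComponentIn (hKU hx)) y
    (hK.subset_connectedComponentIn hx hKU hy)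
  exact ⟨γ.extend, γ.continuous_extend, fun _ ↦ connectedComponentIn_subset U x (hγ _),
    γ.extend_zero, γ.extend_one⟩

theorem not_disjoint_of_turns {K L : Set Plane} (hK : IsClosed K) (hK' : IsPreconnected K)
    (hL : IsClosed L) (hL' : IsPreconnected L) {v₁ v₂ t₁ t₂ c₁ c₂ d₁ d₂ : Plane}
    (hv₁ : v₁ ∈ K) (hv₂ : v₂ ∈ K) (ht₁ : t₁ ∈ L) (ht₂ : t₂ ∈ L)
    (hc₁ : ∀ y ∈ L, 0 < wedge c₁ (y - v₁)) (hc₂ : ∀ y ∈ L, 0 < wedge c₂ (y - v₂))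
    (hd₁ : ∀ x ∈ K, 0 < wedge d₁ (t₁ - x)) (hd₂ : ∀ x ∈ K, 0 < wedge d₂ (t₂ - x))
    (h₁ : 0 < wedge (t₁ - v₁) (t₂ - v₁)) (h₂ : 0 < wedge (t₂ - v₁) (t₂ - v₂))
    (h₃ : 0 < wedge (t₂ - v₂) (t₁ - v₂)) (h₄ : 0 < wedge (t₁ - v₂) (t₁ - v₁)) :
    ¬Disjoint K L := by
  intro hdisj
  obtain ⟨U, V, hU, hV, hKU, hLV, hUV⟩ := normal_separation hK hL hdisj
  have hleft (c v : Plane) : IsOpen {y | 0 < wedge c (y - v)} :=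
    isOpen_lt continuous_const (by fun_prop)
  have hright (d t : Plane) : IsOpen {x | 0 < wedge d (t - x)} :=
    isOpen_lt continuous_const (by fun_prop)
  obtain ⟨γ, hγ, hγU, rfl, rfl⟩ := exists_curve_of_isPreconnected hK'
    ((hU.inter (hright d₁ t₁)).inter (hright d₂ t₂))
    (fun x hx ↦ ⟨⟨hKU hx, hd₁ x hx⟩, hd₂ x hx⟩) hv₁ hv₂
  obtain ⟨δ, hδ, hδV, rfl, rfl⟩ := exists_curve_of_isPreconnected hL'
    ((hV.inter (hleft c₁ (γ 0))).inter (hleft c₂ (γ 1)))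
    (fun y hy ↦ ⟨⟨hLV hy, hc₁ y hy⟩, hc₂ y hy⟩) ht₁ ht₂
  obtain ⟨s, t, hst⟩ := exists_eq_of_turns hγ hδ (fun t ↦ (hδV t).1.2) (fun t ↦ (hδV t).2)
    (fun s ↦ (hγU s).1.2) (fun s ↦ (hγU s).2) h₁ h₂ h₃ h₄
  exact hUV.ne_of_mem (hγU s).1.1 (hδV t).1.1 hst

end Quadrilateral

section Crossing

theorem wedge_nonneg_of_backward {a b q s a' : Plane} (hab : wedge a b ≠ 0) (hq : q ≠ 0)
    (haq : 0 ≤ wedge a q) (hbq : 0 ≤ wedge b q) (hbs : 0 ≤ wedge b s)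
    (hqs : wedge a b * wedge q s ≤ 0) (hq' : wedge a' q ≤ 0) (hs' : wedge a' s < wedge a' q) :
    0 ≤ wedge a s := by
  by_contra! has
  -- Now no term of the Plücker relation of `a b q s` is positive, so all of them vanish.
  have hplucker := wedge_plucker a b q s
  have hqs₀ : wedge q s = 0 := by
    have : wedge a b * wedge q s = 0 := by nlinarith
    exact (mul_eq_zero.1 this).resolve_left hab
  have hbq₀ : wedge b q = 0 := by nlinarith
  have haq₀ : 0 < wedge a q := by
    refine haq.lt_of_ne fun haq₀ ↦ hq ?_
    simpa [← haq₀, hbq₀, hab] using wedge_smul_eq a b q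
  have hplucker' := wedge_plucker a a' q s
  rw [hqs₀] at hplucker'
  have haq_hs' : wedge a q * wedge a' s < 0 := mul_neg_of_pos_of_neg haq₀ (hs'.trans_le hq')
  have has_hq' : 0 ≤ wedge a s * wedge a' q := mul_nonneg_of_nonpos_of_nonpos has.le hq'
  linarith

/-- `p` is a common boundary point of `C` and `D` at which the two boundaries cross: travelling
from `v ∈ C` to `p` and on to `t ∈ D` one has `C` on the left before `p` and `D` on the left after
`p`, with a right turn at `p`. -/
structure IsCrossing (C D : Set Plane) (p v t : Plane) : Prop where
  mem_left : p ∈ C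
  mem_right : p ∈ D
  start_mem : v ∈ C
  end_mem : t ∈ D
  left : ∀ x ∈ C, 0 ≤ wedge (p - v) (x - p)
  right : ∀ y ∈ D, 0 ≤ wedge (t - p) (y - p)
  turn : wedge (p - v) (t - p) < 0

namespace IsCrossing

variable {C D : Set Plane} {p v t p₁ v₁ t₁ p₂ v₂ t₂ : Plane}

theorem wedge_sub_start_pos (h : IsCrossing C D p v t) {y : Plane} (hy : y ∈ D) :
    0 < wedge (t - p) (y - v) := by
  have hright := h.right y hy
  have hturn := h.turn
  simp only [wedge, PiLp.sub_apply] at *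
  linarith

theorem wedge_end_sub_pos (h : IsCrossing C D p v t) {x : Plane} (hx : x ∈ C) :
    0 < wedge (v - p) (t - x) := by
  have hleft := h.left x hx
  have hturn := h.turn
  simp only [wedge, PiLp.sub_apply] at *
  linarith

theorem wedge_start_pos (h₁ : IsCrossing C D p₁ v₁ t₁) (h₂ : IsCrossing C D p₂ v₂ t₂)
    (hne : p₁ ≠ p₂) : 0 < wedge (t₁ - v₁) (t₂ - v₁) := by
  have hp₁ := h₂.left p₁ h₁.mem_left
  have hp₁' := h₂.right p₁ h₁.mem_right
  have hturn₂ := h₂.turn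
  have hkey : 0 ≤ wedge (p₁ - v₁) (t₂ - p₁) := by
    refine wedge_nonneg_of_backward (a' := p₂ - v₂) h₁.turn.ne (sub_ne_zero.2 hne.symm)
      (h₁.left p₂ h₂.mem_left) (h₁.right p₂ h₂.mem_right) (h₁.right t₂ h₂.end_mem)
      (mul_nonpos_of_nonpos_of_nonneg h₁.turn.le ?_) ?_ ?_ <;>
    simp only [wedge, PiLp.sub_apply] at * <;> linarith
  have ht₂ := h₁.right t₂ h₂.end_mem
  have hturn₁ := h₁.turn
  simp only [wedge, PiLp.sub_apply] at *
  linarith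

theorem wedge_end_pos (h₁ : IsCrossing C D p₁ v₁ t₁) (h₂ : IsCrossing C D p₂ v₂ t₂)
    (hne : p₁ ≠ p₂) : 0 < wedge (t₁ - v₂) (t₁ - v₁) := by
  have hp₁ := h₂.left p₁ h₁.mem_left
  have hp₁' := h₂.right p₁ h₁.mem_right
  have hturn₁ := h₁.turn
  have hturn₂ := h₂.turn
  have hkey : 0 ≤ wedge (t₁ - p₁) (v₂ - p₁) := by
    have hturn : 0 < wedge (t₁ - p₁) (p₁ - v₁) := by
      simp only [wedge, PiLp.sub_apply] at *
      linarith
    refine wedge_nonneg_of_backward (a' := t₂ - p₂) hturn.ne' (sub_ne_zero.2 hne.symm)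
      (h₁.right p₂ h₂.mem_right) (h₁.left p₂ h₂.mem_left) (h₁.left v₂ h₂.start_mem)
      (mul_nonpos_of_nonneg_of_nonpos hturn.le ?_) ?_ ?_ <;>
    simp only [wedge, PiLp.sub_apply] at * <;> linarith
  have hv₂ := h₁.left v₂ h₂.start_mem
  simp only [wedge, PiLp.sub_apply] at *
  linarith

theorem eq_of_disjoint {K L : Set Plane} (hK : IsClosed K) (hK' : IsPreconnected K)
    (hL : IsClosed L) (hL' : IsPreconnected L) (hdisj : Disjoint K L) (hKC : K ⊆ C) (hLD : L ⊆ D)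
    (h₁ : IsCrossing C D p₁ v₁ t₁) (h₂ : IsCrossing C D p₂ v₂ t₂) (hv₁ : v₁ ∈ K) (hv₂ : v₂ ∈ K)
    (ht₁ : t₁ ∈ L) (ht₂ : t₂ ∈ L) : p₁ = p₂ := by
  by_contra hne
  exact not_disjoint_of_turns hK hK' hL hL' hv₁ hv₂ ht₁ ht₂
    (fun y hy ↦ h₁.wedge_sub_start_pos (hLD hy)) (fun y hy ↦ h₂.wedge_sub_start_pos (hLD hy))
    (fun x hx ↦ h₁.wedge_end_sub_pos (hKC hx)) (fun x hx ↦ h₂.wedge_end_sub_pos (hKC hx))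
    (h₁.wedge_start_pos h₂ hne) (h₂.wedge_end_pos h₁ (Ne.symm hne))
    (h₂.wedge_start_pos h₁ (Ne.symm hne)) (h₁.wedge_end_pos h₂ hne) hdisj

end IsCrossing

end Crossing

section Face

theorem exists_dual_le_of_notMem_interior {E : Type*} [NormedAddCommGroup E] [NormedSpace ℝ E]
    [FiniteDimensional ℝ E] {C : Set E} (hC : Convex ℝ C) {p : E} (hp : p ∈ C)
    (hp' : p ∉ interior C) : ∃ f : StrongDual ℝ E, f ≠ 0 ∧ ∀ x ∈ C, f x ≤ f p := by
  by_cases hint : (interior C).Nonempty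
  · exact geometric_hahn_banach_of_nonempty_interior_point hC hp' hint
  rw [hC.interior_nonempty_iff_affineSpan_eq_top,
    AffineSubspace.affineSpan_eq_top_iff_vectorSpan_eq_top_of_nonempty ℝ E E ⟨p, hp⟩] at hint
  obtain ⟨f, hf, hspan⟩ :=
    Submodule.exists_dual_map_eq_bot_of_lt_top (lt_top_iff_ne_top.2 hint) inferInstance
  refine ⟨f.toContinuousLinearMap, by simpa using hf, fun x hx ↦ (sub_eq_zero.1 ?_).le⟩
  rw [← map_sub]
  exact (Submodule.eq_bot_iff _).1 hspan _
    (Submodule.mem_map_of_mem (vsub_mem_vectorSpan ℝ hx hp))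

theorem mem_convexHull_inter_level {E : Type*} [AddCommGroup E] [Module ℝ E] {V : Set E} {p : E}
    (hp : p ∈ convexHull ℝ V) {f : E →ₗ[ℝ] ℝ} (hf : ∀ x ∈ V, f x ≤ f p) :
    p ∈ convexHull ℝ (V ∩ {x | f x = f p}) := by
  set F := convexHull ℝ (V ∩ {x | f x = f p})
  have hFle : ∀ x ∈ {x | f x < f p} ∪ F, f x ≤ f p := by
    rintro x (hx | hx)
    · exact le_of_lt hx
    · exact (convexHull_min Set.inter_subset_right
        (convex_hyperplane f.isLinear _) hx : f x = f p).le
  have hconv : Convex ℝ ({x | f x < f p} ∪ F) := by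
    refine convex_iff_forall_pos.2 fun x hx y hy a b ha hb hab ↦ ?_
    have hxle := hFle x hx
    have hyle := hFle y hy
    have hfp : f p = a * f p + b * f p := by rw [← add_mul, hab, one_mul]
    have hfxy : f (a • x + b • y) = a * f x + b * f y := by simp
    rcases hx with hx | hx
    · refine Or.inl (hfxy.trans_lt (hfp ▸ ?_))
      exact add_lt_add_of_lt_of_le (mul_lt_mul_of_pos_left hx ha) (by gcongr)
    rcases hy with hy | hy
    · refine Or.inl (hfxy.trans_lt (hfp ▸ ?_))
      exact add_lt_add_of_le_of_lt (by gcongr) (mul_lt_mul_of_pos_left hy hb)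
    · exact Or.inr (convex_convexHull ℝ _ hx hy ha.le hb.le hab)
  have hVF : V ⊆ {x | f x < f p} ∪ F := fun x hx ↦
    (hf x hx).lt_or_eq.imp id fun h ↦ subset_convexHull ℝ _ ⟨hx, h⟩
  exact (convexHull_min hVF hconv hp).resolve_left (lt_irrefl (f p))

end Face

section Edge

/-- The points of `V` are in general position in the sense that no three distinct ones lie on a
line. -/
def NoThreeCollinear {E : Type*} [AddCommGroup E] [Module ℝ E] (V : Set E) : Prop :=
  ∀ x ∈ V, ∀ y ∈ V, ∀ z ∈ V, x ≠ y → y ≠ z → x ≠ z → ¬Collinear ℝ {x, y, z}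

theorem NoThreeCollinear.mono {E : Type*} [AddCommGroup E] [Module ℝ E] {V W : Set E}
    (hW : NoThreeCollinear W) (hVW : V ⊆ W) : NoThreeCollinear V :=
  fun x hx y hy z hz ↦ hW x (hVW hx) y (hVW hy) z (hVW hz)

theorem NoThreeCollinear.notMem_of_mem_openSegment {E : Type*} [AddCommGroup E] [Module ℝ E]
    {V : Set E} (hV : NoThreeCollinear V) {v w p : E} (hv : v ∈ V) (hw : w ∈ V) (hvw : v ≠ w)
    (hp : p ∈ openSegment ℝ v w) : p ∉ V := by
  intro hpV
  have hwbtw : Wbtw ℝ v p w := mem_segment_iff_wbtw.1 (openSegment_subset_segment ℝ v w hp)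
  refine hV v hv p hpV w hw ?_ ?_ hvw hwbtw.collinear
  · rintro rfl
    exact hvw (left_mem_openSegment_iff.1 hp)
  · rintro rfl
    exact hvw (right_mem_openSegment_iff.1 hp)

theorem NoThreeCollinear.exists_mem_openSegment {E : Type*} [AddCommGroup E] [Module ℝ E]
    {F : Set E} (hF : NoThreeCollinear F) (hline : Collinear ℝ F) {p : E}
    (hp : p ∈ convexHull ℝ F) (hpF : p ∉ F) :
    ∃ v ∈ F, ∃ w ∈ F, v ≠ w ∧ p ∈ openSegment ℝ v w := by
  obtain ⟨v, hv, w, hw, hvw⟩ : F.Nontrivial := by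
    rw [← Set.not_subsingleton_iff]
    intro hsub
    rw [(Set.Subsingleton.convex hsub).convexHull_eq] at hp
    exact hpF hp
  have hFvw : F ⊆ {v, w} := by
    intro z hz
    by_contra! hne
    simp only [Set.mem_insert_iff, Set.mem_singleton_iff, not_or] at hne
    refine hF v hv w hw z hz hvw (Ne.symm hne.2) (Ne.symm hne.1) (hline.subset ?_)
    simp [Set.insert_subset_iff, hv, hw, hz]
  have hseg : p ∈ segment ℝ v w := convexHull_pair (𝕜 := ℝ) v w ▸ convexHull_mono hFvw hp
  exact ⟨v, hv, w, hw, hvw, mem_openSegment_of_ne_left_right (fun h ↦ hpF (h ▸ hv))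
    (fun h ↦ hpF (h ▸ hw)) hseg⟩

theorem collinear_of_wedge_eq_zero {c : Plane} (hc : c ≠ 0) {s : Set Plane} {p : Plane}
    (hs : ∀ x ∈ s, wedge c (x - p) = 0) : Collinear ℝ s := by
  refine (collinear_iff_exists_forall_eq_smul_vadd s).2 ⟨p, c, fun x hx ↦ ?_⟩
  obtain ⟨t, ht⟩ := (wedge_eq_zero_iff hc).1 (hs x hx)
  exact ⟨t, by rw [vadd_eq_add, ← ht, sub_add_cancel]⟩

/-- `v w` is an edge of the convex hull of `V`, directed so that the hull lies on its left. -/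
structure IsHullEdge (V : Set Plane) (v w : Plane) : Prop where
  start_mem : v ∈ V
  end_mem : w ∈ V
  ne : v ≠ w
  left : ∀ x ∈ convexHull ℝ V, 0 ≤ wedge (w - v) (x - v)

theorem isHullEdge_or_isHullEdge {V : Set Plane} {v w c : Plane} (hc₀ : c ≠ 0) (hv : v ∈ V)
    (hw : w ∈ V) (hne : v ≠ w) (hvw : wedge c (w - v) = 0)
    (hc : ∀ x ∈ convexHull ℝ V, wedge c (x - v) ≤ 0) : IsHullEdge V v w ∨ IsHullEdge V w v := by
  obtain ⟨t, ht⟩ := (wedge_eq_zero_iff hc₀).1 hvw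
  have hscale (x : Plane) : wedge (w - v) (x - v) = t * wedge c (x - v) := by
    rw [ht, wedge_smul_left]
  have hreverse (x : Plane) : wedge (v - w) (x - w) = -wedge (w - v) (x - v) := by
    simp only [wedge, PiLp.sub_apply]
    ring
  rcases le_total t 0 with hneg | hpos
  · exact Or.inl ⟨hv, hw, hne, fun x hx ↦
      hscale x ▸ mul_nonneg_of_nonpos_of_nonpos hneg (hc x hx)⟩
  · refine Or.inr ⟨hw, hv, hne.symm, fun x hx ↦ ?_⟩
    rw [hreverse, hscale, neg_nonneg]
    exact mul_nonpos_of_nonneg_of_nonpos hpos (hc x hx)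

theorem exists_isHullEdge {V : Set Plane} (hV : NoThreeCollinear V) {p : Plane}
    (hp : p ∈ convexHull ℝ V) (hp' : p ∉ interior (convexHull ℝ V)) (hpV : p ∉ V) :
    ∃ v w, IsHullEdge V v w ∧ p ∈ openSegment ℝ v w := by
  obtain ⟨f, hf₀, hf⟩ := exists_dual_le_of_notMem_interior (convex_convexHull ℝ V) hp hp'
  obtain ⟨c, hc⟩ := exists_eq_wedge f
  have hc₀ : c ≠ 0 := by
    rintro rfl
    exact hf₀ (ContinuousLinearMap.ext fun x ↦ by simp [hc, wedge])
  set F := V ∩ {x | f x = f p}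
  have hpF : p ∈ convexHull ℝ F :=
    mem_convexHull_inter_level (f := f.toLinearMap) hp fun x hx ↦ hf x (subset_convexHull ℝ V hx)
  have hline : ∀ x ∈ F, wedge c (x - p) = 0 := fun x hx ↦ by
    rw [← hc, map_sub, sub_eq_zero]
    exact hx.2
  obtain ⟨v, hv, w, hw, hvw, hseg⟩ := (hV.mono Set.inter_subset_left).exists_mem_openSegment
    (collinear_of_wedge_eq_zero hc₀ hline) hpF fun h ↦ hpV h.1
  have hlevel : ∀ x ∈ convexHull ℝ V, wedge c (x - v) ≤ 0 := fun x hx ↦ by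
    rw [← hc, map_sub, sub_nonpos, (hv.2 : f v = f p)]
    exact hf x hx
  have hvw₀ : wedge c (w - v) = 0 := by
    rw [← hc, map_sub, sub_eq_zero, (hv.2 : f v = f p), (hw.2 : f w = f p)]
  rcases isHullEdge_or_isHullEdge hc₀ hv.1 hw.1 hvw hvw₀ hlevel with h | h
  · exact ⟨v, w, h, hseg⟩
  · exact ⟨w, v, h, openSegment_symm ℝ v w ▸ hseg⟩

end Edge

section HullCrossing

theorem exists_smul_of_mem_openSegment {E : Type*} [AddCommGroup E] [Module ℝ E] {v w p : E}
    (hp : p ∈ openSegment ℝ v w) :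
    (∃ a > (0 : ℝ), p - v = a • (w - v)) ∧ ∃ b > (0 : ℝ), w - p = b • (w - v) := by
  obtain ⟨b, a, hb, ha, hab, rfl⟩ := hp
  obtain rfl : b = 1 - a := by linarith
  exact ⟨⟨a, ha, by module⟩, ⟨1 - a, hb, by module⟩⟩

variable {V W : Set Plane} {v w z t p : Plane}

theorem wedge_sub_eq_of_mem_openSegment (hp : p ∈ openSegment ℝ v w) (x : Plane) :
    wedge (w - v) (x - p) = wedge (w - v) (x - v) := by
  obtain ⟨⟨a, -, ha⟩, -⟩ := exists_smul_of_mem_openSegment hp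
  obtain rfl : p = a • (w - v) + v := sub_eq_iff_eq_add.1 ha
  simp only [wedge, PiLp.sub_apply, PiLp.add_apply, PiLp.smul_apply, smul_eq_mul]
  ring

theorem IsHullEdge.isCrossing (hvw : IsHullEdge V v w) (hzt : IsHullEdge W z t)
    (hp : p ∈ openSegment ℝ v w) (hp' : p ∈ openSegment ℝ z t)
    (hturn : wedge (w - v) (t - z) < 0) :
    IsCrossing (convexHull ℝ V) (convexHull ℝ W) p v t := by
  obtain ⟨⟨a, ha, hpv⟩, -⟩ := exists_smul_of_mem_openSegment hp
  obtain ⟨-, b, hb, htp⟩ := exists_smul_of_mem_openSegment hp'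
  have hv := subset_convexHull ℝ V hvw.start_mem
  have ht := subset_convexHull ℝ W hzt.end_mem
  refine ⟨(convex_convexHull ℝ V).openSegment_subset hv
      (subset_convexHull ℝ V hvw.end_mem) hp,
    (convex_convexHull ℝ W).openSegment_subset (subset_convexHull ℝ W hzt.start_mem) ht hp',
    hv, ht, fun x hx ↦ ?_, fun y hy ↦ ?_, ?_⟩
  · rw [hpv, wedge_smul_left, wedge_sub_eq_of_mem_openSegment hp]
    exact mul_nonneg ha.le (hvw.left x hx)
  · rw [htp, wedge_smul_left, wedge_sub_eq_of_mem_openSegment hp']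
    exact mul_nonneg hb.le (hzt.left y hy)
  · rw [hpv, htp, wedge_smul_left, wedge_smul_right]
    exact mul_neg_of_pos_of_neg ha (mul_neg_of_pos_of_neg hb hturn)

theorem IsHullEdge.wedge_ne_zero (hU : NoThreeCollinear (V ∪ W)) (hVW : Disjoint V W)
    (hvw : IsHullEdge V v w) (hzt : IsHullEdge W z t) (hp : p ∈ openSegment ℝ v w)
    (hp' : p ∈ openSegment ℝ z t) : wedge (w - v) (t - z) ≠ 0 := by
  intro hzero
  obtain ⟨⟨a, -, hpz⟩, -⟩ := exists_smul_of_mem_openSegment hp'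
  have hz : wedge (w - v) (z - v) = 0 := by
    rw [← wedge_sub_eq_of_mem_openSegment hp, ← neg_sub p z, hpz, ← neg_smul, wedge_smul_right,
      hzero, mul_zero]
  refine hU v (Or.inl hvw.start_mem) w (Or.inl hvw.end_mem) z (Or.inr hzt.start_mem) hvw.ne
    (hVW.ne_of_mem hvw.end_mem hzt.start_mem) (hVW.ne_of_mem hvw.start_mem hzt.start_mem)
    (collinear_of_wedge_eq_zero (sub_ne_zero.2 hvw.ne.symm) (p := v) ?_)
  rintro x (rfl | rfl | rfl)
  · rw [sub_self, ← zero_smul ℝ x, wedge_smul_right, zero_mul]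
  · exact wedge_self _
  · exact hz

theorem notMem_of_notMem_interior_convexHull (hU : NoThreeCollinear (V ∪ W)) (hVW : Disjoint V W)
    (hp : p ∈ convexHull ℝ W) (hp' : p ∉ interior (convexHull ℝ W)) : p ∉ V := by
  intro hpV
  obtain ⟨z, t, hzt, hpzt⟩ := exists_isHullEdge (hU.mono Set.subset_union_right) hp hp'
    fun hpW ↦ hVW.ne_of_mem hpV hpW rfl
  exact hU.notMem_of_mem_openSegment (Or.inr hzt.start_mem) (Or.inr hzt.end_mem) hzt.ne hpzt
    (Or.inl hpV)

theorem exists_isCrossing (hU : NoThreeCollinear (V ∪ W)) (hVW : Disjoint V W)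
    (hpV : p ∈ convexHull ℝ V) (hpV' : p ∉ interior (convexHull ℝ V))
    (hpW : p ∈ convexHull ℝ W) (hpW' : p ∉ interior (convexHull ℝ W)) :
    ∃ v ∈ V, ∃ t ∈ W, IsCrossing (convexHull ℝ V) (convexHull ℝ W) p v t ∨
      IsCrossing (convexHull ℝ W) (convexHull ℝ V) p t v := by
  obtain ⟨v, w, hvw, hpvw⟩ := exists_isHullEdge (hU.mono Set.subset_union_left) hpV hpV'
    (notMem_of_notMem_interior_convexHull hU hVW hpW hpW')
  obtain ⟨z, t, hzt, hpzt⟩ := exists_isHullEdge (hU.mono Set.subset_union_right) hpW hpW'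
    (notMem_of_notMem_interior_convexHull (Set.union_comm V W ▸ hU) hVW.symm hpV hpV')
  rcases (hvw.wedge_ne_zero hU hVW hzt hpvw hpzt).lt_or_gt with hturn | hturn
  · exact ⟨v, hvw.start_mem, t, hzt.end_mem, Or.inl (hvw.isCrossing hzt hpvw hpzt hturn)⟩
  · refine ⟨w, hvw.end_mem, z, hzt.start_mem, Or.inr (hzt.isCrossing hvw hpzt hpvw ?_)⟩
    rwa [wedge_swap, neg_lt_zero]

theorem encard_frontier_convexHull_inter_le_two {K L : Set Plane}
    (hU : NoThreeCollinear (V ∪ W)) (hV : IsClosed (convexHull ℝ V))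
    (hW : IsClosed (convexHull ℝ W)) (hK : IsClosed K) (hK' : IsPreconnected K)
    (hL : IsClosed L) (hL' : IsPreconnected L) (hKL : Disjoint K L) (hVK : V ⊆ K)
    (hKV : K ⊆ convexHull ℝ V) (hWL : W ⊆ L) (hLW : L ⊆ convexHull ℝ W) :
    (frontier (convexHull ℝ V) ∩ frontier (convexHull ℝ W)).encard ≤ 2 := by
  let A := {p | ∃ v ∈ V, ∃ t ∈ W, IsCrossing (convexHull ℝ V) (convexHull ℝ W) p v t}
  let B := {p | ∃ v ∈ V, ∃ t ∈ W, IsCrossing (convexHull ℝ W) (convexHull ℝ V) p t v}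
  have hA : A.Subsingleton := fun p₁ ⟨v₁, hv₁, t₁, ht₁, h₁⟩ p₂ ⟨v₂, hv₂, t₂, ht₂, h₂⟩ ↦
    h₁.eq_of_disjoint hK hK' hL hL' hKL hKV hLW h₂ (hVK hv₁) (hVK hv₂) (hWL ht₁) (hWL ht₂)
  have hB : B.Subsingleton := fun p₁ ⟨v₁, hv₁, t₁, ht₁, h₁⟩ p₂ ⟨v₂, hv₂, t₂, ht₂, h₂⟩ ↦
    h₁.eq_of_disjoint hL hL' hK hK' hKL.symm hLW hKV h₂ (hWL ht₁) (hWL ht₂) (hVK hv₁) (hVK hv₂)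
  have hsub : frontier (convexHull ℝ V) ∩ frontier (convexHull ℝ W) ⊆ A ∪ B := by
    rw [hV.frontier_eq, hW.frontier_eq]
    rintro p ⟨⟨hpV, hpV'⟩, hpW, hpW'⟩
    obtain ⟨v, hv, t, ht, h | h⟩ :=
      exists_isCrossing hU (hKL.mono hVK hWL) hpV hpV' hpW hpW'
    · exact Or.inl ⟨v, hv, t, ht, h⟩
    · exact Or.inr ⟨v, hv, t, ht, h⟩
  calc (frontier (convexHull ℝ V) ∩ frontier (convexHull ℝ W)).encard
      ≤ (A ∪ B).encard := Set.encard_le_encard hsub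
    _ ≤ A.encard + B.encard := Set.encard_union_le A B
    _ ≤ 1 + 1 := add_le_add (Set.encard_le_one_iff_subsingleton.2 hA)
      (Set.encard_le_one_iff_subsingleton.2 hB)
    _ = 2 := one_add_one_eq_two

end HullCrossing

section Polygon

theorem mem_of_isBounded_connectedComponentIn_compl {E : Type*} [NormedAddCommGroup E]
    [NormedSpace ℝ E] {B C : Set E} (hC : Convex ℝ C) (hBC : B ⊆ C) (hB : B.Nonempty) {x : E}
    (hx : Bornology.IsBounded (connectedComponentIn Bᶜ x)) : x ∈ C := by
  by_contra hxC
  obtain ⟨b, hb⟩ := hB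
  have hbx : 0 < dist b x := dist_pos.2 fun h ↦ hxC (h ▸ hBC hb)
  -- Beyond `x`, the ray from `b` through `x` avoids `B`: a point of `B` on it would put `x` between
  -- two points of `C`.
  let ray : Set E := AffineMap.lineMap b x '' Set.Ici (1 : ℝ)
  have hrayB : ray ⊆ Bᶜ := by
    rintro _ ⟨r, hr, rfl⟩ hrB
    have hr₀ : (0 : ℝ) < r := zero_lt_one.trans_le hr
    refine hxC ?_
    have hmem := hC.lineMap_mem (hBC hb) (hBC hrB)
      (t := r⁻¹) ⟨inv_nonneg.2 hr₀.le, inv_le_one_of_one_le₀ hr⟩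
    rwa [AffineMap.lineMap_lineMap_right, inv_mul_cancel₀ hr₀.ne', AffineMap.lineMap_apply_one]
      at hmem
  have hray : ray ⊆ connectedComponentIn Bᶜ x :=
    (isPreconnected_Ici.image _ AffineMap.lineMap_continuous.continuousOn)
      |>.subset_connectedComponentIn ⟨1, Set.self_mem_Ici, AffineMap.lineMap_apply_one b x⟩ hrayB
  obtain ⟨R, hR⟩ := (hx.subset hray).subset_closedBall b
  have hfar : AffineMap.lineMap b x (1 + |R| / dist b x) ∈ Metric.closedBall b R :=
    hR ⟨_, le_add_of_nonneg_right (a := (1 : ℝ)) (by positivity), rfl⟩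
  rw [Metric.mem_closedBall, dist_lineMap_left, Real.norm_of_nonneg (by positivity), add_mul,
    one_mul, div_mul_cancel₀ _ hbx.ne'] at hfar
  linarith [le_abs_self R]

theorem isClosed_segment {E : Type*} [AddCommGroup E] [TopologicalSpace E]
    [IsTopologicalAddGroup E] [Module ℝ E] [ContinuousSMul ℝ E] [T2Space E] (x y : E) :
    IsClosed (segment ℝ x y) := by
  rw [← convexHull_pair]
  exact (Set.toFinite {x, y}).isClosed_convexHull (𝕜 := ℝ)

namespace SimplePolygon

variable (P : SimplePolygon)

theorem boundary_eq_iUnion_segment : P.boundary =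
    ⋃ i, segment ℝ (P.toPolygon.vertices i) (P.toPolygon.vertices (finRotate P.n i)) := by
  simp only [boundary, Polygon.boundary, Polygon.edgeSet, affineSegment_eq_segment]

theorem isClosed_boundary : IsClosed P.boundary := by
  rw [boundary_eq_iUnion_segment]
  exact isClosed_iUnion_of_finite fun i ↦ isClosed_segment _ _

theorem vertexSet_subset_boundary : P.vertexSet ⊆ P.boundary := by
  rw [boundary_eq_iUnion_segment]
  rintro _ ⟨i, rfl⟩
  exact Set.mem_iUnion.2 ⟨i, left_mem_segment ℝ _ _⟩

theorem vertexSet_subset_region : P.vertexSet ⊆ P.region :=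
  P.vertexSet_subset_boundary.trans Set.subset_union_left

theorem boundary_nonempty : P.boundary.Nonempty :=
  have : NeZero P.n := ⟨(three_pos.trans_le P.three_le).ne'⟩
  (Set.range_nonempty _).mono P.vertexSet_subset_boundary

theorem boundary_subset_convexHull : P.boundary ⊆ convexHull ℝ P.vertexSet := by
  rw [boundary_eq_iUnion_segment]
  exact Set.iUnion_subset fun i ↦ segment_subset_convexHull ⟨i, rfl⟩ ⟨_, rfl⟩

theorem region_subset_convexHull : P.region ⊆ convexHull ℝ P.vertexSet :=
  Set.union_subset P.boundary_subset_convexHull fun _ hx ↦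
    mem_of_isBounded_connectedComponentIn_compl (convex_convexHull ℝ _)
      P.boundary_subset_convexHull P.boundary_nonempty hx.2

theorem isClosed_region : IsClosed P.region := by
  rw [← isOpen_compl_iff, isOpen_iff_mem_nhds]
  intro x hx
  have hxb : x ∈ P.boundaryᶜ := fun h ↦ hx (Or.inl h)
  have hopen : IsOpen (connectedComponentIn P.boundaryᶜ x) :=
    P.isClosed_boundary.isOpen_compl.connectedComponentIn
  filter_upwards [hopen.mem_nhds (mem_connectedComponentIn hxb)] with y hy hyr
  rcases hyr with h | ⟨-, h⟩
  · exact connectedComponentIn_subset _ _ hy h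
  · rw [← connectedComponentIn_eq hy] at h
    exact hx (Or.inr ⟨hxb, h⟩)

end SimplePolygon

/-- The set of all vertices of a set of polygons. -/
def vertexUnion (Q : Set SimplePolygon) : Set Plane := ⋃ P ∈ Q, P.vertexSet

theorem finite_vertexUnion {Q : Set SimplePolygon} (hQ : Q.Finite) : (vertexUnion Q).Finite :=
  hQ.biUnion fun _ _ ↦ Set.finite_range _

theorem vertexUnion_subset_polyUnion (Q : Set SimplePolygon) : vertexUnion Q ⊆ polyUnion Q :=
  Set.iUnion₂_mono fun P _ ↦ P.vertexSet_subset_region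

theorem hull_eq_convexHull_vertexUnion (Q : Set SimplePolygon) :
    hull Q = convexHull ℝ (vertexUnion Q) := by
  refine Set.Subset.antisymm (convexHull_min ?_ (convex_convexHull ℝ _))
    (convexHull_mono (vertexUnion_subset_polyUnion Q))
  exact Set.iUnion₂_subset fun P hP ↦ P.region_subset_convexHull.trans
    (convexHull_mono (Set.subset_biUnion_of_mem (u := SimplePolygon.vertexSet) hP))

end Polygon

section Bridge

variable {I P₁ P₂ Q R : Set SimplePolygon} {S S₁ S₂ : Set PlaneSegment}

theorem IsPolygonInput.noThreeCollinear (hI : IsPolygonInput I) (h₁ : P₁ ⊆ I) (h₂ : P₂ ⊆ I) :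
    NoThreeCollinear (vertexUnion P₁ ∪ vertexUnion P₂) :=
  NoThreeCollinear.mono hI.generalPosition
    (Set.union_subset (Set.biUnion_subset_biUnion_left h₁) (Set.biUnion_subset_biUnion_left h₂))

theorem IsPolygonInput.disjoint_polyUnion (hI : IsPolygonInput I) (h₁ : P₁ ⊆ I) (h₂ : P₂ ⊆ I)
    (h : Disjoint P₁ P₂) : Disjoint (polyUnion P₁) (polyUnion P₂) :=
  Set.disjoint_iUnion₂_left.2 fun _ hA ↦ Set.disjoint_iUnion₂_right.2 fun _ hB ↦
    hI.disjoint (h₁ hA) (h₂ hB) (h.ne_of_mem hA hB)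

namespace BridgeableBy

theorem isClosed (h : BridgeableBy I Q S) (hQ : Q.Finite) :
    IsClosed (polyUnion Q ∪ segUnion S) :=
  (hQ.isClosed_biUnion fun P _ ↦ P.isClosed_region).union
    (h.finite.isClosed_biUnion fun s _ ↦ isClosed_segment s.a s.b)

theorem union_subset_convexHull (h : BridgeableBy I Q S) :
    polyUnion Q ∪ segUnion S ⊆ convexHull ℝ (vertexUnion Q) := by
  rw [← hull_eq_convexHull_vertexUnion]
  exact Set.union_subset (subset_convexHull ℝ _) (Set.iUnion₂_subset h.subset_hull)

theorem disjoint_polyUnion_segUnion (h : BridgeableBy I Q S) (hR : R ⊆ I) (hRQ : Disjoint R Q) :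
    Disjoint (polyUnion R) (segUnion S) :=
  Set.disjoint_iUnion₂_left.2 fun P hP ↦ Set.disjoint_iUnion₂_right.2 fun s hs ↦
    Set.disjoint_left.2 fun x hxP hxs ↦
      hRQ.ne_of_mem hP (h.mem_of_meets s hs P (hR hP) ⟨x, hxs, hxP⟩) rfl

theorem disjoint_union (h₁ : BridgeableBy I P₁ S₁) (h₂ : BridgeableBy I P₂ S₂)
    (hI : IsPolygonInput I) (hP : Disjoint P₁ P₂)
    (hS : ∀ s₁ ∈ S₁, ∀ s₂ ∈ S₂, Disjoint s₁.carrier s₂.carrier) :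
    Disjoint (polyUnion P₁ ∪ segUnion S₁) (polyUnion P₂ ∪ segUnion S₂) :=
  Set.disjoint_union_left.2
    ⟨Set.disjoint_union_right.2 ⟨hI.disjoint_polyUnion h₁.subset h₂.subset hP,
      h₂.disjoint_polyUnion_segUnion h₁.subset hP⟩,
    Set.disjoint_union_right.2 ⟨(h₁.disjoint_polyUnion_segUnion h₂.subset hP.symm).symm,
      Set.disjoint_iUnion₂_left.2 fun s₁ hs₁ ↦ Set.disjoint_iUnion₂_right.2 (hS s₁ hs₁)⟩⟩

end BridgeableBy

end Bridge

theorem mainTheorem5_general {I P₁ P₂ : Set SimplePolygon} (hI : IsPolygonInput I)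
    {S₁ S₂ : Set PlaneSegment} (h₁ : BridgeableBy I P₁ S₁) (h₂ : BridgeableBy I P₂ S₂)
    (hP : Disjoint P₁ P₂) (hS : ∀ s₁ ∈ S₁, ∀ s₂ ∈ S₂, Disjoint s₁.carrier s₂.carrier) :
    (frontier (hull P₁) ∩ frontier (hull P₂)).encard ≤ 2 := by
  have hP₁ := hI.finite.subset h₁.subset
  have hP₂ := hI.finite.subset h₂.subset
  rw [hull_eq_convexHull_vertexUnion P₁, hull_eq_convexHull_vertexUnion P₂]
  exact encard_frontier_convexHull_inter_le_two (hI.noThreeCollinear h₁.subset h₂.subset)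
    ((finite_vertexUnion hP₁).isClosed_convexHull (𝕜 := ℝ))
    ((finite_vertexUnion hP₂).isClosed_convexHull (𝕜 := ℝ))
    (h₁.isClosed hP₁) h₁.connected.isPreconnected (h₂.isClosed hP₂) h₂.connected.isPreconnected
    (h₁.disjoint_union h₂ hI hP hS) ((vertexUnion_subset_polyUnion P₁).trans Set.subset_union_left)
    h₁.union_subset_convexHull ((vertexUnion_subset_polyUnion P₂).trans Set.subset_union_left)
    h₂.union_subset_convexHull

theorem mainTheorem5 (I : Set SimplePolygon) (hI : IsPolygonInput I)
    (P₁ P₂ : Set SimplePolygon) (h : Compatible I P₁ P₂) :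
    (frontier (hull P₁) ∩ frontier (hull P₂)).encard ≤ 2 := by
  obtain ⟨hP, ⟨S₁, S₂, h₁, h₂, hS⟩, -⟩ := h
  exact mainTheorem5_general hI h₁ h₂ hP hS
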